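/- Theorem 3.1. Let $k$ be a field and let $T$ be a skeletally small $k$-linear triangulated category with suspension $\Sigma$, with split idempotents, and with all $\operatorname{Hom}$ spaces finite dimensional over $k$. Let $\mathcal C$ be a full subcategory of $T$ closed under extensions and direct summands, up to isomorphism: if $A\to B\to C\to\Sigma A$ is a distinguished triangle with $A,C\in\mathcal C$, then $B$ is isomorphic to an object of $\mathcal C$; and if $A\in\mathcal C$ and $A\cong A_1\amalg A_2$, then $A_1$ and $A_2$ are isomorphic to objects of $\mathcal C$. For a full subcategory $\mathcal D$ of $T$, a distinguished triangle $A\xrightarrow{a}B\xrightarrow{b}C\xrightarrow{c}\Sigma A$ with $A,B,C\in\mathcal D$ is an Auslander–Reiten triangle in $\mathcal D$ if $c\neq 0$, each morphism $A\to A'$ with $A'\in\mathcal D$ which is not a section (split monomorphism) factors through $a$, and each morphism $C'\to C$ with $C'\in\mathcal D$ which is not a retraction (split epimorphism) factors through $b$. A $\mathcal C$-cover of an object $X$ of $T$ is a morphism $\alpha:A\to X$ with $A\in\mathcal C$ such that each morphism $A'\to X$ with $A'\in\mathcal C$ factors through $\alpha$, and such that each endomorphism $e$ of $A$ with $\alpha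 e=\alpha$ is an isomorphism. Let $C\in\mathcal C$, suppose that there are $A'\in\mathcal C$ and a non-zero morphism $C\to\Sigma A'$, and let $X\to Y\to C\to\Sigma X$ be an Auslander–Reiten triangle in $T$. Then for each object $A$ of $T$ the following are equivalent: 1. $X$ has a $\mathcal C$-cover of the form $A\to X$; 2. there is an Auslander–Reiten triangle in $\mathcal C$ of the form $A\to B\to C\to\Sigma A$. In particular, $X$ has a $\mathcal C$-cover if and only if there is an Auslander–Reiten triangle in $\mathcal C$ ending in $C$. -/

import Mathlib

open CategoryTheory CategoryTheory.Limits CategoryTheory.Pretriangulated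

universe w v u

namespace ARTriangles

/-- The full subcategory given by `P` is closed under direct summands, up to isomorphism: if an
object of `P` is isomorphic to `A₁ ⊞ A₂`, then `A₁` and `A₂` are isomorphic to objects of `P`. -/
def ClosedUnderDirectSummands {T : Type u} [Category.{v} T] [Preadditive T]
    [HasBinaryBiproducts T] (P : ObjectProperty T) : Prop :=
  ∀ ⦃A A₁ A₂ : T⦄, P A → Nonempty (A ≅ A₁ ⊞ A₂) → P.isoClosure A₁ ∧ P.isoClosure A₂

/-- A `P`-precover of `X`: a morphism `α : A ⟶ X` with `A` in `P` through which every morphism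
from an object of `P` to `X` factors. -/
structure IsPrecover {T : Type u} [Category.{v} T] (P : ObjectProperty T) {A X : T}
    (α : A ⟶ X) : Prop where
  mem : P A
  fac : ∀ ⦃A' : T⦄ (f : A' ⟶ X), P A' → ∃ g : A' ⟶ A, g ≫ α = f

/-- A `P`-cover of `X`: a right-minimal `P`-precover. -/
structure IsCover {T : Type u} [Category.{v} T] (P : ObjectProperty T) {A X : T}
    (α : A ⟶ X) : Prop extends IsPrecover P α where
  minimal : ∀ e : A ⟶ A, e ≫ α = α → IsIso e

/-- The triangle `A ⟶ B ⟶ C ⟶ A⟦1⟧` is an Auslander-Reiten triangle in the full subcategory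
given by `P`. An Auslander-Reiten triangle in the whole category is the case `P = ⊤`. -/
structure IsARTriangle {T : Type u} [Category.{v} T] [Preadditive T] [HasZeroObject T]
    [HasShift T ℤ] [∀ n : ℤ, (shiftFunctor T n).Additive] [Pretriangulated T]
    (P : ObjectProperty T) {A B C : T} (a : A ⟶ B) (b : B ⟶ C) (c : C ⟶ A⟦(1 : ℤ)⟧) : Prop where
  distinguished : Triangle.mk a b c ∈ distTriang T
  mem_left : P A
  mem_middle : P B
  mem_right : P C
  ne_zero : c ≠ 0
  left_fac : ∀ ⦃A' : T⦄ (f : A ⟶ A'), P A' → ¬ IsSplitMono f → ∃ g : B ⟶ A', a ≫ g = f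
  right_fac : ∀ ⦃C' : T⦄ (f : C' ⟶ C), P C' → ¬ IsSplitEpi f → ∃ g : C' ⟶ B, g ≫ b = f

end ARTriangles

/-! Both directions rest on a morphism `α : A ⟶ X` whose shift carries `c` to the connecting
morphism `d`. Given a cover `α`, a non-zero `C ⟶ A'⟦1⟧` can be continued to `d`, and the
continuation factors through `α`; this yields `c`. Composition with `α⟦1⟧'` is injective on maps
from objects of `P` (Wakamatsu), so right factorization is inherited from `d`. For left
factorization, an `f` not killed by `c` is continued to an endomorphism of `A` fixing `c`, which
splits by a Fitting argument. Conversely, an Auslander-Reiten triangle in `P` yields `α`, and a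
linear form not vanishing on `d` gives a Serre-type pairing showing that all maps from `P` to `X`
factor through `α`. -/

/-- If a bilinear form on finite dimensional spaces is nondegenerate on the left, and a subspace `S`
on the left has trivial orthogonal complement, then `S` is everything. -/
theorem LinearMap.eq_top_of_forall_exists_ne_zero {k V W : Type*} [Field k] [AddCommGroup V]
    [Module k V] [AddCommGroup W] [Module k W] [FiniteDimensional k V] [FiniteDimensional k W]
    (B : V →ₗ[k] W →ₗ[k] k) (hB : ∀ v, v ≠ 0 → ∃ w, B v w ≠ 0) (S : Submodule k V)
    (hS : ∀ w, w ≠ 0 → ∃ v ∈ S, B v w ≠ 0) : S = ⊤ := by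
  have hB' : Function.Injective B := by
    refine (injective_iff_map_eq_zero B).2 fun v hv => ?_
    by_contra hv0
    obtain ⟨w, hw⟩ := hB v hv0
    exact hw (by simp [hv])
  have hS' : Function.Injective (B.domRestrict S).flip := by
    refine (injective_iff_map_eq_zero _).2 fun w hw => ?_
    by_contra hw0
    obtain ⟨v, hvS, hv⟩ := hS w hw0
    exact hv (by simpa using LinearMap.congr_fun hw ⟨v, hvS⟩)
  -- Hence dim V ≤ dim W ≤ dim S.
  have h₁ := LinearMap.finrank_le_finrank_of_injective hB'
  have h₂ := LinearMap.finrank_le_finrank_of_injective hS'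
  have h₃ : Module.finrank k (W →ₗ[k] k) = Module.finrank k W := Subspace.dual_finrank_eq
  have h₄ : Module.finrank k (S →ₗ[k] k) = Module.finrank k S := Subspace.dual_finrank_eq
  exact Submodule.eq_top_of_finrank_eq (le_antisymm S.finrank_le (by omega))

namespace ARTriangles

/-- Composing with `e` is an injective linear endomorphism of a finite dimensional space, so it hits
the identity. -/
theorem isIso_of_isSplitMono_of_finiteDimensional (k : Type*) [Field k] {T : Type u}
    [Category.{v} T] [Preadditive T] [Linear k T] {A : T} [FiniteDimensional k (A ⟶ A)]
    (e : A ⟶ A) [IsSplitMono e] : IsIso e := by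
  have hinj : Function.Injective (Linear.rightComp k A e) := fun f g h => by
    simpa [cancel_mono] using h
  obtain ⟨s, hs⟩ := LinearMap.surjective_of_injective hinj (𝟙 A)
  have : IsSplitEpi e := ⟨⟨s, hs⟩⟩
  exact isIso_of_mono_of_isSplitEpi e

theorem rightComp_shift_pow_apply (k : Type*) [Field k] {T : Type u}
    [Category.{v} T] [Preadditive T] [Linear k T] [HasShift T ℤ] {A C : T} (n : End A) (m : ℕ)
    (g : C ⟶ A⟦(1 : ℤ)⟧) :
    ((Linear.rightComp k C (n⟦(1 : ℤ)⟧') : Module.End k (C ⟶ A⟦(1 : ℤ)⟧)) ^ m) g =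
      g ≫ (n ^ m : End A)⟦(1 : ℤ)⟧' := by
  induction m generalizing g with
  | zero => simp [End.one_def]
  | succ m ih =>
    rw [pow_succ, Module.End.mul_apply, ih, pow_succ, End.mul_def, Functor.map_comp]
    simp

section

variable {T : Type u} [Category.{v} T] [Preadditive T] [HasZeroObject T]
  [HasShift T ℤ] [∀ n : ℤ, (shiftFunctor T n).Additive] [Pretriangulated T]
  {P : ObjectProperty T}

/-- An extension of `P`-objects with prescribed connecting morphism can be chosen in `P`. -/
theorem exists_distinguished_of_mem (hext : P.IsTriangulatedClosed₂) {A C : T} (hA : P A)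
    (hC : P C) (c : C ⟶ A⟦(1 : ℤ)⟧) :
    ∃ (B : T) (a : A ⟶ B) (b : B ⟶ C), P B ∧ Triangle.mk a b c ∈ distTriang T := by
  obtain ⟨W, p, q, hT⟩ := distinguished_cocone_triangle₂ c
  obtain ⟨B, hB, ⟨(i : W ≅ B)⟩⟩ := hext.ext₂' _ hT hA hC
  refine ⟨B, p ≫ i.hom, i.inv ≫ q, hB, isomorphic_distinguished _ hT _ ?_⟩
  exact Triangle.isoMk _ (Triangle.mk p q c) (Iso.refl A) i.symm (Iso.refl C)
    (show (p ≫ i.hom) ≫ i.inv = 𝟙 A ≫ p by simp)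
    (show (i.inv ≫ q) ≫ 𝟙 C = i.inv ≫ q by simp)
    (show c ≫ (𝟙 A)⟦(1 : ℤ)⟧' = 𝟙 C ≫ c by simp)

theorem exists_comp_eq_of_comp_shift_eq_zero {A B C : T} {a : A ⟶ B} {b : B ⟶ C}
    {c : C ⟶ A⟦(1 : ℤ)⟧} (hT : Triangle.mk a b c ∈ distTriang T) {A' : T} (f : A ⟶ A')
    (hf : c ≫ f⟦(1 : ℤ)⟧' = 0) : ∃ g : B ⟶ A', a ≫ g = f := by
  obtain ⟨w, hw, -⟩ := complete_distinguished_triangle_morphism₂ _ _ hT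
    (contractible_distinguished A') f 0 (hf.trans zero_comp.symm)
  exact ⟨w, hw.trans (Category.comp_id f)⟩

theorem IsARTriangle.comp_eq_zero_of_not_isSplitEpi {A B C : T} {a : A ⟶ B} {b : B ⟶ C}
    {c : C ⟶ A⟦(1 : ℤ)⟧} (h : IsARTriangle P a b c) {C' : T} (hC' : P C') (f : C' ⟶ C)
    (hf : ¬ IsSplitEpi f) : f ≫ c = 0 := by
  obtain ⟨g, rfl⟩ := h.right_fac f hC' hf
  have : b ≫ c = 0 := comp_distTriang_mor_zero₂₃ _ h.distinguished
  rw [Category.assoc, this, comp_zero]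

theorem IsARTriangle.comp_shift_eq_zero_of_not_isSplitMono {A B C : T} {a : A ⟶ B} {b : B ⟶ C}
    {c : C ⟶ A⟦(1 : ℤ)⟧} (h : IsARTriangle P a b c) {A' : T} (hA' : P A') (f : A ⟶ A')
    (hf : ¬ IsSplitMono f) : c ≫ f⟦(1 : ℤ)⟧' = 0 := by
  obtain ⟨g, rfl⟩ := h.left_fac f hA' hf
  have : c ≫ a⟦(1 : ℤ)⟧' = 0 := comp_distTriang_mor_zero₃₁ _ h.distinguished
  rw [Functor.map_comp, reassoc_of% this, zero_comp]

/-- The connecting morphism of an Auslander-Reiten triangle factors through every non-zero morphism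
`C ⟶ A'⟦1⟧`. -/
theorem IsARTriangle.exists_comp_shift_eq (hext : P.IsTriangulatedClosed₂) {A B C : T}
    {a : A ⟶ B} {b : B ⟶ C} {c : C ⟶ A⟦(1 : ℤ)⟧} (h : IsARTriangle P a b c) {A' : T}
    (hA' : P A') (g : C ⟶ A'⟦(1 : ℤ)⟧) (hg : g ≠ 0) : ∃ f : A' ⟶ A, g ≫ f⟦(1 : ℤ)⟧' = c := by
  obtain ⟨W, p, q, hW, hT⟩ := exists_distinguished_of_mem hext hA' h.mem_right g
  have hqg : q ≫ g = 0 := comp_distTriang_mor_zero₂₃ _ hT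
  have hq : ¬ IsSplitEpi q := fun _ => hg (by rw [← cancel_epi q, hqg, comp_zero])
  obtain ⟨f, hf⟩ := Triangle.yoneda_exact₃ _ hT c (h.comp_eq_zero_of_not_isSplitEpi hW q hq)
  obtain ⟨f', rfl⟩ := (shiftFunctor T (1 : ℤ)).map_surjective f
  exact ⟨f', hf.symm⟩

/-- The connecting morphism of an Auslander-Reiten triangle factors through every non-zero morphism
`A' ⟶ X`, up to a shift. -/
theorem IsARTriangle.exists_comp_shift_eq_of_ne_zero {X Y C : T} {x : X ⟶ Y} {y : Y ⟶ C}
    {d : C ⟶ X⟦(1 : ℤ)⟧} (h : IsARTriangle ⊤ x y d) {A' : T} (f : A' ⟶ X) (hf : f ≠ 0) :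
    ∃ g : C ⟶ A'⟦(1 : ℤ)⟧, g ≫ f⟦(1 : ℤ)⟧' = d := by
  obtain ⟨Z, s, t, hT⟩ := distinguished_cocone_triangle f
  have hfs : f ≫ s = 0 := comp_distTriang_mor_zero₁₂ _ hT
  have hs : ¬ IsSplitMono s := fun _ => hf (by rw [← cancel_mono s, hfs, zero_comp])
  obtain ⟨g, hg⟩ := Triangle.coyoneda_exact₁ _ (rot_of_distTriang _ hT) d
    (h.comp_shift_eq_zero_of_not_isSplitMono trivial s hs)
  change C ⟶ A'⟦(1 : ℤ)⟧ at g
  replace hg : d = g ≫ (-f⟦(1 : ℤ)⟧') := hg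
  exact ⟨-g, by rw [hg, Preadditive.neg_comp, Preadditive.comp_neg]⟩

/-- A version of Wakamatsu's lemma: morphisms to the shift of a cover are detected after composition
with the shifted cover. -/
theorem IsCover.eq_zero_of_comp_shift_eq_zero (hext : P.IsTriangulatedClosed₂) {A X : T}
    {α : A ⟶ X} (h : IsCover P α) {C : T} (hC : P C) (g : C ⟶ A⟦(1 : ℤ)⟧)
    (hg : g ≫ α⟦(1 : ℤ)⟧' = 0) : g = 0 := by
  obtain ⟨W, i, q, hW, hT⟩ := exists_distinguished_of_mem hext h.mem hC g
  -- `α` extends along `i` and factors back through itself; minimality then makes `i` split, which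
  -- forces `g = 0`.
  obtain ⟨w, hw⟩ := exists_comp_eq_of_comp_shift_eq_zero hT α hg
  obtain ⟨r, rfl⟩ := h.fac w hW
  have := h.minimal (i ≫ r) (by simpa using hw)
  have hi : g ≫ i⟦(1 : ℤ)⟧' = 0 := comp_distTriang_mor_zero₃₁ _ hT
  rw [← cancel_mono ((i ≫ r)⟦(1 : ℤ)⟧'), Functor.map_comp, reassoc_of% hi, zero_comp, zero_comp]

theorem IsCover.comp_shift_injective (hext : P.IsTriangulatedClosed₂) {A X : T}
    {α : A ⟶ X} (h : IsCover P α) {C : T} (hC : P C) {g g' : C ⟶ A⟦(1 : ℤ)⟧}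
    (hg : g ≫ α⟦(1 : ℤ)⟧' = g' ≫ α⟦(1 : ℤ)⟧') : g = g' :=
  sub_eq_zero.1 (h.eq_zero_of_comp_shift_eq_zero hext hC _ (by rw [Preadditive.sub_comp, hg, sub_self]))

section Linear

variable (k : Type*) [Field k] [Linear k T] [∀ U V : T, FiniteDimensional k (U ⟶ V)]

include k

/-- An endomorphism of a cover of `X` fixing a lift of the connecting morphism of the
Auslander-Reiten triangle starting in `X` is a split monomorphism. -/
theorem IsCover.isSplitMono_of_comp_shift_eq (hext : P.IsTriangulatedClosed₂) {X Y C : T}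
    {x : X ⟶ Y} {y : Y ⟶ C} {d : C ⟶ X⟦(1 : ℤ)⟧} (hd : IsARTriangle ⊤ x y d) (hC : P C)
    {A : T} {α : A ⟶ X} (hα : IsCover P α) {c : C ⟶ A⟦(1 : ℤ)⟧} (hc : c ≫ α⟦(1 : ℤ)⟧' = d)
    (e : A ⟶ A) (he : c ≫ e⟦(1 : ℤ)⟧' = c) : IsSplitMono e := by
  let e' : End A := e
  let n : End A := 1 - e'
  let φ : Module.End k (C ⟶ A⟦(1 : ℤ)⟧) := Linear.rightComp k C (n⟦(1 : ℤ)⟧')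
  have hφ : ∀ m g, (φ ^ m) g = g ≫ (n ^ m : End A)⟦(1 : ℤ)⟧' := rightComp_shift_pow_apply k n
  have hφc : φ c = 0 := by
    have : c ≫ (𝟙 A - e)⟦(1 : ℤ)⟧' = 0 := by simp [Functor.map_sub, he]
    exact this
  -- Fitting: `m ≥ 1` puts `c` in the kernel of `φ ^ m`; if `N ≫ α ≠ 0`, it would also lie in the
  -- range.
  obtain ⟨m, hdisj, hm⟩ := ((Module.End.eventually_disjoint_ker_pow_range_pow φ).and
    (Filter.eventually_ge_atTop 1)).exists
  obtain ⟨N, hN⟩ : ∃ N : A ⟶ A, N = (n ^ m : End A) := ⟨_, rfl⟩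
  have hNα : N ≫ α = 0 := by
    by_contra hne
    obtain ⟨g, hg⟩ := hd.exists_comp_shift_eq_of_ne_zero _ hne
    have hgc : (φ ^ m) g = c := by
      rw [hφ, ← hN]
      exact hα.comp_shift_injective hext hC (by rw [hc, ← hg, Functor.map_comp, Category.assoc])
    have hker : (φ ^ m) c = 0 := by
      obtain ⟨m, rfl⟩ := Nat.exists_eq_add_of_le' hm
      rw [pow_succ, Module.End.mul_apply, hφc, map_zero]
    have hc0 : c = 0 := Submodule.disjoint_def.1 hdisj c hker ⟨g, hgc⟩
    exact hd.ne_zero (by rw [← hc, hc0, zero_comp])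
  have := hα.minimal (𝟙 A - N) (by
    rw [Preadditive.sub_comp, hNα, sub_zero, Category.id_comp])
  -- `1 - n` divides `1 - n ^ m` by the geometric sum.
  obtain ⟨s, hs⟩ : ∃ s : A ⟶ A, e ≫ s = 𝟙 A - N := by
    have := geom_sum_mul_neg n m
    rw [show 1 - n = e' from sub_sub_cancel 1 e', ← hN] at this
    exact ⟨_, this⟩
  exact ⟨⟨s ≫ inv (𝟙 A - N), by rw [reassoc_of% hs, IsIso.hom_inv_id]⟩⟩

theorem IsCover.exists_isARTriangle (hext : P.IsTriangulatedClosed₂) {X Y C : T}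
    {x : X ⟶ Y} {y : Y ⟶ C} {d : C ⟶ X⟦(1 : ℤ)⟧} (hd : IsARTriangle ⊤ x y d) (hC : P C)
    (hne : ∃ A' : T, P A' ∧ ∃ c : C ⟶ A'⟦(1 : ℤ)⟧, c ≠ 0) {A : T} {α : A ⟶ X}
    (hα : IsCover P α) : ∃ (B : T) (a : A ⟶ B) (b : B ⟶ C) (c : C ⟶ A⟦(1 : ℤ)⟧),
      IsARTriangle P a b c := by
  have htop : (⊤ : ObjectProperty T).IsTriangulatedClosed₂ :=
    ⟨fun _ _ _ _ => ObjectProperty.le_isoClosure _ _ trivial⟩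
  have lift : ∀ {A' : T}, P A' → ∀ g : C ⟶ A'⟦(1 : ℤ)⟧, g ≠ 0 →
      ∃ u : A' ⟶ A, (g ≫ u⟦(1 : ℤ)⟧') ≫ α⟦(1 : ℤ)⟧' = d := by
    intro A' hA' g hg
    obtain ⟨f, hf⟩ := hd.exists_comp_shift_eq htop trivial g hg
    obtain ⟨u, rfl⟩ := hα.fac f hA'
    exact ⟨u, by simpa using hf⟩
  obtain ⟨A', hA', g, hg⟩ := hne
  obtain ⟨u, hu⟩ := lift hA' g hg
  obtain ⟨c, hc⟩ : ∃ c : C ⟶ A⟦(1 : ℤ)⟧, c ≫ α⟦(1 : ℤ)⟧' = d := ⟨_, hu⟩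
  obtain ⟨B, a, b, hB, hT⟩ := exists_distinguished_of_mem hext hα.mem hC c
  refine ⟨B, a, b, c, hT, hα.mem, hB, hC, ?_, ?_, ?_⟩
  · rintro rfl
    exact hd.ne_zero (by rw [← hc, zero_comp])
  · intro A'' f hA'' hf
    have hcf : c ≫ f⟦(1 : ℤ)⟧' = 0 := by
      by_contra hcf
      obtain ⟨u, hu⟩ := lift hA'' _ hcf
      have he : c ≫ (f ≫ u)⟦(1 : ℤ)⟧' = c :=
        hα.comp_shift_injective hext hC (by rw [hc, ← hu]; simp)
      have := hα.isSplitMono_of_comp_shift_eq k hext hd hC hc (f ≫ u) he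
      exact hf ⟨⟨u ≫ retraction (f ≫ u), by
        rw [← Category.assoc]; exact IsSplitMono.id (f ≫ u)⟩⟩
    exact exists_comp_eq_of_comp_shift_eq_zero hT f hcf
  · intro C' f hC' hf
    have hfc : f ≫ c = 0 := by
      refine hα.eq_zero_of_comp_shift_eq_zero hext hC' _ ?_
      rw [Category.assoc, hc, hd.comp_eq_zero_of_not_isSplitEpi trivial f hf]
    obtain ⟨w, hw⟩ := Triangle.coyoneda_exact₃ _ hT f hfc
    exact ⟨w, hw.symm⟩

theorem IsARTriangle.exists_isCover (hext : P.IsTriangulatedClosed₂) {X Y C : T}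
    {x : X ⟶ Y} {y : Y ⟶ C} {d : C ⟶ X⟦(1 : ℤ)⟧} (hd : IsARTriangle ⊤ x y d) {A B : T}
    {a : A ⟶ B} {b : B ⟶ C} {c : C ⟶ A⟦(1 : ℤ)⟧} (h : IsARTriangle P a b c) :
    ∃ α : A ⟶ X, IsCover P α := by
  have hbc : b ≫ c = 0 := comp_distTriang_mor_zero₂₃ _ h.distinguished
  have hb : ¬ IsSplitEpi b := fun _ => h.ne_zero (by rw [← cancel_epi b, hbc, comp_zero])
  obtain ⟨g, hg⟩ := hd.right_fac b trivial hb
  obtain ⟨α, hα⟩ : ∃ α : A ⟶ X, c ≫ α⟦(1 : ℤ)⟧' = d := by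
    obtain ⟨α, -, hα⟩ := complete_distinguished_triangle_morphism₁ _ _ h.distinguished
      hd.distinguished g (𝟙 C) ((Category.comp_id b).trans hg.symm)
    exact ⟨α, hα.trans (Category.id_comp d)⟩
  refine ⟨α, ⟨h.mem_left, fun A' f hA' => ?_⟩, fun e he => ?_⟩
  · obtain ⟨θ, hθ⟩ := Module.Projective.exists_dual_ne_zero k hd.ne_zero
    let β : (A'⟦(1 : ℤ)⟧ ⟶ X⟦(1 : ℤ)⟧) →ₗ[k] (C ⟶ A'⟦(1 : ℤ)⟧) →ₗ[k] k :=
      ((Linear.comp C (A'⟦(1 : ℤ)⟧) (X⟦(1 : ℤ)⟧)).compr₂ θ).flip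
    have hβ : ∀ f g, β f g = θ (g ≫ f) := fun _ _ => rfl
    have hS := LinearMap.eq_top_of_forall_exists_ne_zero β (fun f hf => by
        obtain ⟨f, rfl⟩ := (shiftFunctor T (1 : ℤ)).map_surjective f
        obtain ⟨g, hg⟩ := hd.exists_comp_shift_eq_of_ne_zero f (by rintro rfl; simp at hf)
        exact ⟨g, by rwa [hβ, hg]⟩)
      (LinearMap.range (Linear.rightComp k (A'⟦(1 : ℤ)⟧) (α⟦(1 : ℤ)⟧'))) (fun g hg => by
        obtain ⟨u, hu⟩ := h.exists_comp_shift_eq hext hA' g hg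
        refine ⟨u⟦(1 : ℤ)⟧' ≫ α⟦(1 : ℤ)⟧', ⟨_, rfl⟩, ?_⟩
        rwa [hβ, ← Category.assoc, hu, hα])
    obtain ⟨u, hu⟩ := LinearMap.range_eq_top.1 hS (f⟦(1 : ℤ)⟧')
    obtain ⟨u, rfl⟩ := (shiftFunctor T (1 : ℤ)).map_surjective u
    exact ⟨u, (shiftFunctor T (1 : ℤ)).map_injective (by rw [Functor.map_comp]; exact hu)⟩
  · have : IsSplitMono e := by
      by_contra hes
      have hce := h.comp_shift_eq_zero_of_not_isSplitMono h.mem_left e hes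
      apply hd.ne_zero
      rw [← hα, ← he, Functor.map_comp, reassoc_of% hce, zero_comp]
    exact isIso_of_isSplitMono_of_finiteDimensional k e

end Linear

end

end ARTriangles

theorem theorem3p1 {k : Type*} [Field k] {T : Type u} [Category.{v} T] [Preadditive T]
    [Linear k T] [HasZeroObject T] [HasShift T ℤ] [∀ n : ℤ, (shiftFunctor T n).Additive]
    [Pretriangulated T] [IsTriangulated T] [EssentiallySmall.{w} T] [IsIdempotentComplete T]
    [∀ U V : T, FiniteDimensional k (U ⟶ V)]
    (P : ObjectProperty T) (hext : P.IsTriangulatedClosed₂)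
    (hsum : ARTriangles.ClosedUnderDirectSummands P)
    {C : T} (hC : P C)
    (hne : ∃ A' : T, P A' ∧ ∃ c : C ⟶ A'⟦(1 : ℤ)⟧, c ≠ 0)
    {X Y : T} (x : X ⟶ Y) (y : Y ⟶ C) (d : C ⟶ X⟦(1 : ℤ)⟧)
    (hd : ARTriangles.IsARTriangle ⊤ x y d) :
    ∀ A : T, (∃ α : A ⟶ X, ARTriangles.IsCover P α) ↔
      ∃ (B : T) (a : A ⟶ B) (b : B ⟶ C) (c : C ⟶ A⟦(1 : ℤ)⟧), ARTriangles.IsARTriangle P a b c := by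

  intro A
  exact ⟨fun ⟨_, hα⟩ => hα.exists_isARTriangle k hext hd hC hne,
    fun ⟨_, _, _, _, h⟩ => hd.exists_isCover k hext h⟩
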